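/- Let $s\ge 2$, let $(F,g_F)$ be an $s$-dimensional smooth Riemannian manifold (without boundary) with scalar curvature $\tau_F$, let $f\colon F\to(0,\infty)$ be a smooth function and let $-\infty\le a<b\le\infty$. Put $n=s+1$ and let ${}_f(a,b)\times F$ be the standard static space-time, i.e. the product manifold $(a,b)\times F$ with the Lorentzian metric $g=-f^2\,dt^2\oplus g_F$. Suppose that ${}_f(a,b)\times F$ is Einstein, i.e. $\mathrm{Ric}=\lambda g$ for some smooth function $\lambda$ on $(a,b)\times F$, and that its scalar curvature is a constant $\tau$. Let $\mathrm{Ric}_F$ be the Ricci tensor of $(F,g_F)$, $\mathrm{H}^f_F$ the Hessian form of $f$ on $(F,g_F)$, and $\Delta_F(f)=\mathrm{tr}_{g_F}\mathrm{H}^f_F$ the Laplacian of $f$. Then, everywhere on $F$: a) $\Delta_F(f)=-\frac{\tau}{n}f$ and $\mathrm{Ric}_F=\frac1f\,\mathrm{H}^f_F+\frac{\tau}{n}\,g_F$; b) $(s+1)\,\tau_F=(s-1)\,\tau$. -/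

import Mathlib

set_option maxSynthPendingDepth 3

open Bundle
open scoped Manifold ContDiff

noncomputable section

/-- The pullback `(v, w) ↦ B (A v) (A w)` of a bilinear form `B` under a linear map `A`. -/
def pullbackForm {V W : Type*} [AddCommGroup V] [Module ℝ V] [TopologicalSpace V]
    [AddCommGroup W] [Module ℝ W] [TopologicalSpace W]
    (A : V →L[ℝ] W) (B : W →L[ℝ] W →L[ℝ] ℝ) : V →L[ℝ] V →L[ℝ] ℝ :=
  (ContinuousLinearMap.precomp ℝ A) ∘L B ∘L A

theorem pullbackForm_apply {V W : Type*} [AddCommGroup V] [Module ℝ V] [TopologicalSpace V]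
    [AddCommGroup W] [Module ℝ W] [TopologicalSpace W]
    (A : V →L[ℝ] W) (B : W →L[ℝ] W →L[ℝ] ℝ) (v w : V) :
    pullbackForm A B v w = B (A v) (A w) := rfl

/-! ### Tensor calculus of a metric on an open subset of a vector space -/

namespace MetricCoord

variable {E : Type*} [NormedAddCommGroup E] [NormedSpace ℝ E]

/-- The Christoffel symbols of the first kind of the field of bilinear forms `G` at `y`:
`(u, v) ↦ (w ↦ ½ (∂ᵤ G(v, w) + ∂ᵥ G(u, w) - ∂_w G(u, v)))`. -/
def christoffelFirst (G : E → E →L[ℝ] E →L[ℝ] ℝ) (y : E) : E →L[ℝ] E →L[ℝ] (E →L[ℝ] ℝ) :=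
  (1 / 2 : ℝ) • (fderiv ℝ G y + (fderiv ℝ G y).flip -
    ((ContinuousLinearMap.flipₗᵢ ℝ E E ℝ).toContinuousLinearEquiv.toContinuousLinearMap ∘L
      (fderiv ℝ G y).flip))

theorem christoffelFirst_apply (G : E → E →L[ℝ] E →L[ℝ] ℝ) (y u v w : E) :
    christoffelFirst G y u v w =
      1 / 2 * (fderiv ℝ G y u v w + fderiv ℝ G y v u w - fderiv ℝ G y w u v) := rfl

/-- The Christoffel symbols (of the second kind) `Γ_y(u, v)` of the Levi-Civita connection of the
metric `G`; they are determined by `G_y(Γ_y(u, v), w) = christoffelFirst G y u v w`. -/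
def christoffel (G : E → E →L[ℝ] E →L[ℝ] ℝ) (y : E) : E →L[ℝ] E →L[ℝ] E :=
  (ContinuousLinearMap.compL ℝ E (E →L[ℝ] ℝ) E (G y).inverse) ∘L (christoffelFirst G y)

theorem christoffel_apply (G : E → E →L[ℝ] E →L[ℝ] ℝ) (y u v : E) :
    christoffel G y u v = (G y).inverse (christoffelFirst G y u v) := rfl

/-- For fixed `v, w`, the endomorphism `u ↦ R(u, v) w`, where `R` is the Riemann curvature tensor
`R(X, Y) Z = ∇_X ∇_Y Z - ∇_Y ∇_X Z - ∇_[X,Y] Z` of the metric `G` at `y`. -/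
def curvature (G : E → E →L[ℝ] E →L[ℝ] ℝ) (y v w : E) : E →L[ℝ] E :=
  ((fderiv ℝ (christoffel G) y).flip v).flip w - (fderiv ℝ (christoffel G) y v).flip w
    + (christoffel G y).flip (christoffel G y v w)
    - (christoffel G y v) ∘L ((christoffel G y).flip w)

theorem curvature_apply (G : E → E →L[ℝ] E →L[ℝ] ℝ) (y u v w : E) :
    curvature G y v w u =
      fderiv ℝ (christoffel G) y u v w - fderiv ℝ (christoffel G) y v u w
        + christoffel G y u (christoffel G y v w)
        - christoffel G y v (christoffel G y u w) := rfl

/-- The Ricci tensor `Ric(v, w) = tr (u ↦ R(u, v) w)` of the metric `G` at `y`. -/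
def ricci [FiniteDimensional ℝ E] (G : E → E →L[ℝ] E →L[ℝ] ℝ) (y : E) : E →L[ℝ] E →L[ℝ] ℝ :=
  (LinearMap.mk₂ ℝ (fun v w => LinearMap.trace ℝ E (curvature G y v w).toLinearMap)
    (fun v v' w => by
      rw [← map_add]; congr 1; ext u; simp [curvature_apply]; abel)
    (fun c v w => by
      rw [← map_smul]; congr 1; ext u; simp [curvature_apply, smul_sub, smul_add])
    (fun v w w' => by
      rw [← map_add]; congr 1; ext u; simp [curvature_apply]; abel)
    (fun c v w => by
      rw [← map_smul]; congr 1; ext u;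
      simp [curvature_apply, smul_sub, smul_add])).toContinuousBilinearMap

theorem ricci_apply [FiniteDimensional ℝ E] (G : E → E →L[ℝ] E →L[ℝ] ℝ) (y v w : E) :
    ricci G y v w = LinearMap.trace ℝ E (curvature G y v w).toLinearMap := rfl

/-- The Hessian `∇dh = D²h - Dh(Γ(·, ·))` of the function `h` at `y` for the metric `G`. -/
def hessian (G : E → E →L[ℝ] E →L[ℝ] ℝ) (h : E → ℝ) (y : E) : E →L[ℝ] E →L[ℝ] ℝ :=
  fderiv ℝ (fderiv ℝ h) y
    - (ContinuousLinearMap.compL ℝ E E ℝ (fderiv ℝ h y)) ∘L (christoffel G y)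

theorem hessian_apply (G : E → E →L[ℝ] E →L[ℝ] ℝ) (h : E → ℝ) (y v w : E) :
    hessian G h y v w = fderiv ℝ (fderiv ℝ h) y v w - fderiv ℝ h y (christoffel G y v w) := rfl

end MetricCoord

/-! ### Pseudo-Riemannian manifolds (without boundary) -/

section Manifold

variable {E : Type*} [NormedAddCommGroup E] [NormedSpace ℝ E]
  {H : Type*} [TopologicalSpace H] (I : ModelWithCorners ℝ E H)
  (M : Type*) [TopologicalSpace M] [ChartedSpace H M] [IsManifold I ∞ M]

/-- A smooth pseudo-Riemannian metric on the manifold `M`. -/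
structure PseudoRiemannianMetric where
  inner (x : M) : TangentSpace I x →L[ℝ] TangentSpace I x →L[ℝ] ℝ
  symm (x : M) (v w : TangentSpace I x) : inner x v w = inner x w v
  nondegenerate (x : M) (v : TangentSpace I x) (hv : ∀ w, inner x v w = 0) : v = 0
  contMDiff : ContMDiff I (I.prod 𝓘(ℝ, E →L[ℝ] E →L[ℝ] ℝ)) ∞
    (fun x ↦ TotalSpace.mk' (E →L[ℝ] E →L[ℝ] ℝ) x (inner x))

variable {I M}

/-- A Riemannian metric is a pseudo-Riemannian metric. -/
def Bundle.ContMDiffRiemannianMetric.toPseudo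
    (g : ContMDiffRiemannianMetric I ∞ E (fun x : M ↦ TangentSpace I x)) :
    PseudoRiemannianMetric I M where
  inner := g.inner
  symm := g.symm
  nondegenerate x v hv := by
    by_contra h
    exact (g.pos x v h).ne' (hv v)
  contMDiff := g.contMDiff

namespace PseudoRiemannianMetric

variable (g : PseudoRiemannianMetric I M)

/-- The metric `g` read in the chart at `x₀`: the pullback of `g` under the inverse of the chart. -/
def inChart (x₀ : M) (y : E) : E →L[ℝ] E →L[ℝ] ℝ :=
  let A : E →L[ℝ] TangentSpace I ((extChartAt I x₀).symm y) :=
    mfderiv 𝓘(ℝ, E) I (extChartAt I x₀).symm y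
  pullbackForm A (g.inner ((extChartAt I x₀).symm y))

/-- The differential at `x` of the chart at `x`. -/
def dChart (x : M) : TangentSpace I x →L[ℝ] E :=
  mfderiv I 𝓘(ℝ, E) (extChartAt I x) x

/-- The Ricci tensor of `g` at `x`, computed in the chart at `x`. -/
def ricci [FiniteDimensional ℝ E] (x : M) : TangentSpace I x →L[ℝ] TangentSpace I x →L[ℝ] ℝ :=
  pullbackForm (dChart x) (MetricCoord.ricci (g.inChart x) (extChartAt I x x))

/-- The Hessian form of `h` for `g` at `x`, computed in the chart at `x`. -/
def hessian (h : M → ℝ) (x : M) : TangentSpace I x →L[ℝ] TangentSpace I x →L[ℝ] ℝ :=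
  pullbackForm (dChart x)
    (MetricCoord.hessian (g.inChart x) (h ∘ (extChartAt I x).symm) (extChartAt I x x))

/-- The trace with respect to `g` of a bilinear form `B` on `T_x M`, i.e. the trace of the
endomorphism `B♯` of `T_x M` with `g (B♯ v) w = B v w`. -/
def trace (x : M) (B : TangentSpace I x →L[ℝ] TangentSpace I x →L[ℝ] ℝ) : ℝ :=
  LinearMap.trace ℝ (TangentSpace I x) ((g.inner x).inverse ∘L B).toLinearMap

/-- The scalar curvature of `g`. -/
def scalarCurvature [FiniteDimensional ℝ E] (x : M) : ℝ := g.trace x (g.ricci x)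

/-- The Laplacian `Δ h = tr (Hess h)` for `g`. -/
def laplacian (h : M → ℝ) (x : M) : ℝ := g.trace x (g.hessian h x)

/-- The pseudo-Riemannian manifold `(M, g)` is Einstein: `Ric = lam • g` for a smooth function
`lam`. -/
def IsEinstein [FiniteDimensional ℝ E] : Prop :=
  ∃ lam : M → ℝ, ContMDiff I 𝓘(ℝ, ℝ) ∞ lam ∧
    ∀ (x : M) (v w : TangentSpace I x), g.ricci x v w = lam x * g.inner x v w

end PseudoRiemannianMetric

end Manifold

/-! ### Standard static space-times -/

/-- The open interval `(a, b)` of real numbers, `-∞ ≤ a`, `b ≤ ∞`, as an open submanifold of `ℝ`. -/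
def openInterval (a b : EReal) : TopologicalSpace.Opens ℝ :=
  ⟨{t : ℝ | a < t ∧ (t : EReal) < b},
    (isOpen_lt continuous_const continuous_coe_real_ereal).inter
      (isOpen_lt continuous_coe_real_ereal continuous_const)⟩

section Static

variable {E : Type*} [NormedAddCommGroup E] [NormedSpace ℝ E]
  {H : Type*} [TopologicalSpace H] {J : ModelWithCorners ℝ E H}
  {F : Type*} [TopologicalSpace F] [ChartedSpace H F] [IsManifold J ∞ F]

/-- The differential `dt` at `q` of the coordinate function `t` on `(a, b) × F`. -/
def dTime (J : ModelWithCorners ℝ E H) {a b : EReal} (q : openInterval a b × F) :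
    TangentSpace (𝓘(ℝ, ℝ).prod J) q →L[ℝ] ℝ :=
  mfderiv (𝓘(ℝ, ℝ).prod J) 𝓘(ℝ, ℝ) (fun q : openInterval a b × F ↦ (q.1 : ℝ)) q

/-- The differential `dσ` at `q` of the projection `σ : (a, b) × F → F`. -/
def dFiber (J : ModelWithCorners ℝ E H) {a b : EReal} (q : openInterval a b × F) :
    TangentSpace (𝓘(ℝ, ℝ).prod J) q →L[ℝ] TangentSpace J q.2 :=
  mfderiv (𝓘(ℝ, ℝ).prod J) J (Prod.snd : openInterval a b × F → F) q

/-- The bilinear form `-f² dt² + σ^* g_F` on the tangent space at `q` of `(a, b) × F`. -/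
def staticForm (gF : ContMDiffRiemannianMetric J ∞ E (fun p : F ↦ TangentSpace J p)) (f : F → ℝ)
    (a b : EReal) (q : openInterval a b × F) :
    TangentSpace (𝓘(ℝ, ℝ).prod J) q →L[ℝ] TangentSpace (𝓘(ℝ, ℝ).prod J) q →L[ℝ] ℝ :=
  (-(f q.2) ^ 2) • pullbackForm (dTime J q) (ContinuousLinearMap.mul ℝ ℝ)
    + pullbackForm (dFiber J q) (gF.inner q.2)

section Pullback

open ContinuousLinearMap

variable {E' : Type*} [NormedAddCommGroup E'] [NormedSpace ℝ E']
  {H' : Type*} [TopologicalSpace H'] {I' : ModelWithCorners ℝ E' H'}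
  {M : Type*} [TopologicalSpace M] [ChartedSpace H' M] [IsManifold I' ∞ M]

/-- The pullback of a smooth field of bilinear forms under a smooth map is smooth. -/
theorem contMDiff_pullbackForm {φ : M → F} (hφ : ContMDiff I' J ∞ φ)
    {B : ∀ p : F, TangentSpace J p →L[ℝ] TangentSpace J p →L[ℝ] ℝ}
    (hB : ContMDiff J (J.prod 𝓘(ℝ, E →L[ℝ] E →L[ℝ] ℝ)) ∞
      (fun p ↦ TotalSpace.mk' (E →L[ℝ] E →L[ℝ] ℝ) p (B p))) :
    ContMDiff I' (I'.prod 𝓘(ℝ, E' →L[ℝ] E' →L[ℝ] ℝ)) ∞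
      (fun x ↦ TotalSpace.mk' (E' →L[ℝ] E' →L[ℝ] ℝ) x
        (pullbackForm (mfderiv I' J φ x) (B (φ x)) :
          TangentSpace I' x →L[ℝ] TangentSpace I' x →L[ℝ] ℝ)) := by
  intro x₀
  rw [contMDiffAt_hom_bundle]
  refine ⟨contMDiffAt_id, ?_⟩
  have hA : ContMDiffAt I' 𝓘(ℝ, E' →L[ℝ] E) ∞
      (inTangentCoordinates I' J id φ (mfderiv I' J φ) x₀) x₀ :=
    (hφ x₀).mfderiv_const (by simp)
  have hB' := ((contMDiffAt_hom_bundle _).1 (hB (φ x₀))).2.comp x₀ (hφ x₀)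
  have key : ContMDiffAt I' 𝓘(ℝ, E' →L[ℝ] E' →L[ℝ] ℝ) ∞ (fun x ↦
      ((ContinuousLinearMap.flipₗᵢ ℝ E' E' ℝ).toContinuousLinearEquiv.toContinuousLinearMap
        (((ContinuousLinearMap.flipₗᵢ ℝ E' E ℝ).toContinuousLinearEquiv.toContinuousLinearMap
          ((inCoordinates E (TangentSpace J) (E →L[ℝ] ℝ) (fun p : F ↦ TangentSpace J p →L[ℝ] ℝ)
            (φ x₀) (φ x) (φ x₀) (φ x) (B (φ x))).comp
          (inTangentCoordinates I' J id φ (mfderiv I' J φ) x₀ x))).comp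
          (inTangentCoordinates I' J id φ (mfderiv I' J φ) x₀ x)))) x₀ := by
    refine ContMDiffAt.clm_apply contMDiffAt_const ?_
    refine ContMDiffAt.clm_comp ?_ hA
    refine ContMDiffAt.clm_apply contMDiffAt_const ?_
    exact ContMDiffAt.clm_comp hB' hA
  refine key.congr_of_eventuallyEq ?_
  have h1 : ∀ᶠ x in nhds x₀, x ∈ (trivializationAt E' (TangentSpace I') x₀).baseSet :=
    (trivializationAt E' (TangentSpace I') x₀).open_baseSet.mem_nhds
      (FiberBundle.mem_baseSet_trivializationAt' x₀)
  have h2 : ∀ᶠ x in nhds x₀, φ x ∈ (trivializationAt E (TangentSpace J) (φ x₀)).baseSet :=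
    hφ.continuous.continuousAt ((trivializationAt E (TangentSpace J) (φ x₀)).open_baseSet.mem_nhds
      (FiberBundle.mem_baseSet_trivializationAt' (φ x₀)))
  filter_upwards [h1, h2] with x hx hx'
  ext v w
  erw [inCoordinates_apply_eq₂ hx hx (by simp)]
  change _ = inCoordinates E (TangentSpace J) (E →L[ℝ] ℝ) (fun p : F ↦ TangentSpace J p →L[ℝ] ℝ)
            (φ x₀) (φ x) (φ x₀) (φ x) (B (φ x))
            (inTangentCoordinates I' J id φ (mfderiv I' J φ) x₀ x v)
            (inTangentCoordinates I' J id φ (mfderiv I' J φ) x₀ x w)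
  erw [inCoordinates_apply_eq₂ hx' hx' (by simp)]
  have hv : ∀ v : E', (trivializationAt E (TangentSpace J) (φ x₀)).symm (φ x)
      (inTangentCoordinates I' J id φ (mfderiv I' J φ) x₀ x v) =
      mfderiv I' J φ x ((trivializationAt E' (TangentSpace I') x₀).symm x v) := by
    intro v
    unfold inTangentCoordinates
    erw [inCoordinates_eq hx hx']
    simp only [ContinuousLinearMap.comp_apply, Trivialization.symmL_apply,
      ContinuousLinearEquiv.coe_coe, Trivialization.continuousLinearEquivAt_apply,
      Trivialization.symm_continuousLinearEquivAt_eq, hx]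
    exact Trivialization.symm_apply_apply_mk _ hx' _
  rw [hv, hv]
  simp [pullbackForm_apply]
end Pullback

/-- The inclusion of an open subset of `ℝ` has differential the identity. -/
theorem mfderiv_opens_val (U : TopologicalSpace.Opens ℝ) (t : U) (v : TangentSpace 𝓘(ℝ, ℝ) t) :
    mfderiv 𝓘(ℝ, ℝ) 𝓘(ℝ, ℝ) (Subtype.val : U → ℝ) t v = v := by
  have h := (contMDiff_subtype_val (n := 1) (I := 𝓘(ℝ, ℝ)) (U := U) t).mdifferentiableAt (by simp)
  rw [h.mfderiv]
  simp only [modelWithCornersSelf_coe, Set.range_id, fderivWithin_univ]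
  have : writtenInExtChartAt 𝓘(ℝ, ℝ) 𝓘(ℝ, ℝ) t (Subtype.val : U → ℝ)
      =ᶠ[nhds (extChartAt 𝓘(ℝ, ℝ) t t)] id := by
    filter_upwards [extChartAt_target_mem_nhds (I := 𝓘(ℝ, ℝ)) t] with y hy
    exact (extChartAt 𝓘(ℝ, ℝ) t).right_inv hy
  rw [this.fderiv_eq, fderiv_id]
  rfl

theorem staticForm_contMDiff
    (gF : ContMDiffRiemannianMetric J ∞ E (fun p : F ↦ TangentSpace J p)) (f : F → ℝ)
    (hf : ContMDiff J 𝓘(ℝ, ℝ) ∞ f) (a b : EReal) :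
    ContMDiff (𝓘(ℝ, ℝ).prod J) ((𝓘(ℝ, ℝ).prod J).prod 𝓘(ℝ, (ℝ × E) →L[ℝ] (ℝ × E) →L[ℝ] ℝ)) ∞
      (fun q : openInterval a b × F ↦
        TotalSpace.mk' ((ℝ × E) →L[ℝ] (ℝ × E) →L[ℝ] ℝ) q (staticForm gF f a b q)) := by
  have h2 := contMDiff_pullbackForm (I' := 𝓘(ℝ, ℝ).prod J)
    (φ := (Prod.snd : openInterval a b × F → F)) contMDiff_snd gF.contMDiff
  have h1 := contMDiff_pullbackForm (I' := 𝓘(ℝ, ℝ).prod J) (J := 𝓘(ℝ, ℝ))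
    (φ := fun q : openInterval a b × F ↦ (q.1 : ℝ)) (contMDiff_subtype_val.comp contMDiff_fst)
    (B := fun _ ↦ ContinuousLinearMap.mul ℝ ℝ) (by
      intro x
      rw [contMDiffAt_hom_bundle]
      refine ⟨contMDiffAt_id, ?_⟩
      refine (contMDiffAt_const (c := ContinuousLinearMap.mul ℝ ℝ)).congr_of_eventuallyEq ?_
      filter_upwards with y
      ext
      have hy : y ∈ (trivializationAt ℝ (TangentSpace 𝓘(ℝ, ℝ)) x).baseSet := by
        simp [chartAt_self_eq]
      erw [inCoordinates_apply_eq₂ hy hy (by simp)]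
      have h1 : (trivializationAt ℝ (TangentSpace 𝓘(ℝ, ℝ)) x).symm y (1 : ℝ) = (1 : ℝ) := by
        have := congrArg (fun L : ℝ →L[ℝ] ℝ ↦ L (1 : ℝ))
          (TangentBundle.symmL_model_space (𝕜 := ℝ) (F := ℝ) x y)
        exact (Trivialization.symmL_apply (R := ℝ) _ hy (1 : ℝ)).symm.trans this
      erw [h1]
      have h4 : ∀ z : ℝ, (trivializationAt ℝ (Trivial ℝ ℝ) x).linearMapAt ℝ y z = z := by simp
      exact h4 _)
  have h3 : ContMDiff (𝓘(ℝ, ℝ).prod J) 𝓘(ℝ, ℝ) ∞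
      (fun q : openInterval a b × F ↦ -(f q.2) ^ 2) := by
    have := hf.comp (contMDiff_snd (I := 𝓘(ℝ, ℝ)) (J := J) (M := openInterval a b) (N := F))
    simpa using! (this.pow 2).neg
  exact (h3.smul_section h1).add_section h2

/-- The metric `-f² dt² ⊕ g_F` of the standard static space-time `_f(a, b) × F`. -/
def staticMetric (gF : ContMDiffRiemannianMetric J ∞ E (fun p : F ↦ TangentSpace J p)) (f : F → ℝ)
    (hf : ContMDiff J 𝓘(ℝ, ℝ) ∞ f) (hpos : ∀ p, 0 < f p) (a b : EReal) :
    PseudoRiemannianMetric (𝓘(ℝ, ℝ).prod J) (openInterval a b × F) where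
  inner := staticForm gF f a b
  symm q v w := by
    simp [staticForm, pullbackForm_apply, mul_comm, gF.symm]
  nondegenerate q v hv := by
    have hT : ∀ w : TangentSpace (𝓘(ℝ, ℝ).prod J) q, dTime J q w = w.1 := by
      intro w
      have hc := mfderiv_comp q (I := 𝓘(ℝ, ℝ).prod J) (I' := 𝓘(ℝ, ℝ)) (I'' := 𝓘(ℝ, ℝ))
        (f := (Prod.fst : openInterval a b × F → openInterval a b))
        (g := (Subtype.val : openInterval a b → ℝ))
        ((contMDiff_subtype_val (n := 1) q.1).mdifferentiableAt (by simp)) mdifferentiableAt_fst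
      have : dTime J q w = (mfderiv (𝓘(ℝ, ℝ).prod J) 𝓘(ℝ, ℝ) ((Subtype.val : openInterval a b → ℝ) ∘
        (Prod.fst : openInterval a b × F → openInterval a b)) q) w := rfl
      rw [this, hc, mfderiv_fst]
      exact mfderiv_opens_val _ _ _
    have hS : ∀ w : TangentSpace (𝓘(ℝ, ℝ).prod J) q, dFiber J q w = w.2 := by
      intro w
      simp [dFiber]
      rfl
    have key : ∀ w : TangentSpace (𝓘(ℝ, ℝ).prod J) q,
        -(f q.2) ^ 2 * (v.1 * w.1) + gF.inner q.2 v.2 w.2 = 0 := by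
      intro w
      have := hv w
      simpa [staticForm, pullbackForm_apply, hT, hS] using! this
    have h1 : v.1 = 0 := by
      have := key ((1 : ℝ), (0 : E))
      have hf0 := (hpos q.2).ne'
      have h0 : gF.inner q.2 v.2 (0 : E) = 0 := map_zero _
      simp only [mul_one] at this
      rw [h0] at this
      simpa [hf0] using this
    have h2 : v.2 = 0 := by
      by_contra h
      have := key ((0 : ℝ), v.2)
      have hp := gF.pos q.2 v.2 h
      simp only [mul_zero, zero_add] at this
      exact hp.ne' this
    exact Prod.ext h1 h2
  contMDiff := staticForm_contMDiff gF f hf a b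

end Static

end

noncomputable section

namespace MetricCoord

open Filter Topology

variable {E : Type*} [NormedAddCommGroup E] [NormedSpace ℝ E]

/-- Near `x`, the field of bilinear forms `G` is a `C²` pseudo-Riemannian metric. -/
structure IsMetricNear (G : E → E →L[ℝ] E →L[ℝ] ℝ) (x : E) : Prop where
  contDiffAt : ContDiffAt ℝ 2 G x
  symm : ∀ᶠ y in 𝓝 x, ∀ v w, G y v w = G y w v
  isInvertible : ∀ᶠ y in 𝓝 x, (G y).IsInvertible

theorem IsMetricNear.eventually {G : E → E →L[ℝ] E →L[ℝ] ℝ} {x : E} (h : IsMetricNear G x) :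
    ∀ᶠ y in 𝓝 x, IsMetricNear G y := by
  filter_upwards [h.contDiffAt.eventually (by simp), h.symm.eventually_nhds,
    h.isInvertible.eventually_nhds] with y h1 h2 h3
  exact ⟨h1, h2, h3⟩

theorem IsMetricNear.differentiableAt {G : E → E →L[ℝ] E →L[ℝ] ℝ} {x : E}
    (h : IsMetricNear G x) : DifferentiableAt ℝ G x :=
  h.contDiffAt.differentiableAt (by simp)

section Congruence

variable {G G' : E → E →L[ℝ] E →L[ℝ] ℝ} {x : E}

theorem christoffel_congr (h : G =ᶠ[𝓝 x] G') : christoffel G x = christoffel G' x := by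
  simp only [christoffel, christoffelFirst, h.eq_of_nhds, h.fderiv_eq]

theorem christoffel_eventuallyEq (h : G =ᶠ[𝓝 x] G') : christoffel G =ᶠ[𝓝 x] christoffel G' := by
  filter_upwards [h.eventuallyEq_nhds] with y hy using christoffel_congr hy

theorem curvature_congr (h : G =ᶠ[𝓝 x] G') (v w : E) : curvature G x v w = curvature G' x v w := by
  simp only [curvature, christoffel_congr h, (christoffel_eventuallyEq h).fderiv_eq]

theorem ricci_congr [FiniteDimensional ℝ E] (h : G =ᶠ[𝓝 x] G') : ricci G x = ricci G' x := by
  ext v w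
  simp only [ricci_apply, curvature_congr h]

end Congruence

/-- The derivative of a field of bilinear maps, evaluated on fixed vectors. -/
theorem fderiv_bilin_apply {V W X : Type*} [NormedAddCommGroup V] [NormedSpace ℝ V]
    [NormedAddCommGroup W] [NormedSpace ℝ W] [NormedAddCommGroup X] [NormedSpace ℝ X]
    {K : E → V →L[ℝ] W →L[ℝ] X} {x : E} (hK : DifferentiableAt ℝ K x) (u : E) (v : V) (w : W) :
    fderiv ℝ K x u v w = fderiv ℝ (fun y => K y v w) x u := by
  have h1 : HasFDerivAt (fun y => K y v) ((fderiv ℝ K x).flip v) x := by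
    simpa using hK.hasFDerivAt.clm_apply (hasFDerivAt_const v x)
  have h2 : HasFDerivAt (fun y => K y v w) (((fderiv ℝ K x).flip v).flip w) x := by
    simpa using h1.clm_apply (hasFDerivAt_const w x)
  rw [h2.fderiv]; rfl

/-- A nondegenerate bilinear form on a finite-dimensional space is invertible as a map into the
dual space. -/
theorem isInvertible_of_nondegenerate [FiniteDimensional ℝ E] (B : E →L[ℝ] E →L[ℝ] ℝ)
    (hB : ∀ v, (∀ w, B v w = 0) → v = 0) : B.IsInvertible := by
  have hinj : Function.Injective (B : E →ₗ[ℝ] E →L[ℝ] ℝ) := by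
    rw [injective_iff_map_eq_zero]
    intro v hv
    exact hB v fun w => by
      have : B v = 0 := hv
      simp [this]
  have hdim : Module.finrank ℝ E = Module.finrank ℝ (E →L[ℝ] ℝ) := by
    rw [← (LinearMap.toContinuousLinearMap (𝕜 := ℝ) (E := E) (F' := ℝ)).finrank_eq]
    exact (Subspace.dual_finrank_eq (K := ℝ) (V := E)).symm
  refine ⟨(LinearEquiv.ofInjectiveOfFinrankEq _ hinj hdim).toContinuousLinearEquiv, ?_⟩
  ext v w
  rfl

theorem inverse_eq_of_apply_eq {V W : Type*} [AddCommGroup V] [Module ℝ V] [TopologicalSpace V]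
    [AddCommGroup W] [Module ℝ W] [TopologicalSpace W] {A : V →L[ℝ] W} (hA : A.IsInvertible)
    {v : V} {w : W} (h : A v = w) : A.inverse w = v := by
  rw [← h, hA.inverse_apply_self]

theorem apply_christoffel {G : E → E →L[ℝ] E →L[ℝ] ℝ} {y : E} (h : (G y).IsInvertible)
    (u v w : E) : G y (christoffel G y u v) w = christoffelFirst G y u v w := by
  rw [christoffel_apply, h.self_apply_inverse]

theorem contDiffAt_inverse [CompleteSpace E] {G : E → E →L[ℝ] E →L[ℝ] ℝ} {x : E}
    {n : ℕ∞ω} (hG : ContDiffAt ℝ n G x) (hx : (G x).IsInvertible) :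
    ContDiffAt ℝ n (fun y => (G y).inverse) x :=
  (ContinuousLinearMap.IsInvertible.contDiffAt_map_inverse hx).comp x hG

theorem IsMetricNear.contDiffAt_christoffel [CompleteSpace E] {G : E → E →L[ℝ] E →L[ℝ] ℝ} {x : E}
    (h : IsMetricNear G x) : ContDiffAt ℝ 1 (christoffel G) x := by
  have h1 : ContDiffAt ℝ 1 (fderiv ℝ G) x := h.contDiffAt.fderiv_right (by norm_num)
  have hflip : ContDiffAt ℝ 1 (fun y => (fderiv ℝ G y).flip) x :=
    (ContinuousLinearMap.flipₗᵢ ℝ E E (E →L[ℝ] ℝ)).toContinuousLinearEquiv.contDiff.contDiffAt.comp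
      x h1
  have h2 : ContDiffAt ℝ 1 (christoffelFirst G) x := by
    have h3 : ContDiffAt ℝ 1 (fun y =>
        (ContinuousLinearMap.flipₗᵢ ℝ E E ℝ).toContinuousLinearEquiv.toContinuousLinearMap ∘L
          (fderiv ℝ G y).flip) x := contDiffAt_const.clm_comp hflip
    exact ((h1.add hflip).sub h3).const_smul (1 / 2 : ℝ)
  have h3 : ContDiffAt ℝ 1 (fun y => (G y).inverse) x :=
    contDiffAt_inverse (h.contDiffAt.of_le (by norm_num)) h.isInvertible.self_of_nhds
  exact (((ContinuousLinearMap.compL ℝ E (E →L[ℝ] ℝ) E).contDiff.contDiffAt.comp x h3)).clm_comp h2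

/-- The gradient of `φ` for the metric `G`. -/
def gradient (G : E → E →L[ℝ] E →L[ℝ] ℝ) (φ : E → ℝ) (y : E) : E :=
  (G y).inverse (fderiv ℝ φ y)

theorem apply_gradient {G : E → E →L[ℝ] E →L[ℝ] ℝ} {y : E} (h : (G y).IsInvertible)
    (φ : E → ℝ) (w : E) : G y (gradient G φ y) w = fderiv ℝ φ y w := by
  rw [gradient, h.self_apply_inverse]

theorem IsMetricNear.differentiableAt_gradient [CompleteSpace E] {G : E → E →L[ℝ] E →L[ℝ] ℝ}
    {x : E} (h : IsMetricNear G x) {φ : E → ℝ} (hφ : ContDiffAt ℝ 2 φ x) :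
    DifferentiableAt ℝ (gradient G φ) x := by
  have h1 : ContDiffAt ℝ 1 (fderiv ℝ φ) x := hφ.fderiv_right (by norm_num)
  have h3 : ContDiffAt ℝ 1 (fun y => (G y).inverse) x :=
    contDiffAt_inverse (h.contDiffAt.of_le (by norm_num)) h.isInvertible.self_of_nhds
  exact (h3.clm_apply h1).differentiableAt (by simp)

/-- The covariant derivative of the gradient of `φ` corresponds to the Hessian of `φ`. -/
theorem IsMetricNear.apply_covariant_gradient [CompleteSpace E] {G : E → E →L[ℝ] E →L[ℝ] ℝ}
    {x : E} (h : IsMetricNear G x) {φ : E → ℝ} (hφ : ContDiffAt ℝ 2 φ x) (u w : E) :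
    G x (fderiv ℝ (gradient G φ) x u + christoffel G x u (gradient G φ x)) w =
      hessian G φ x u w := by
  have hinv := h.isInvertible.self_of_nhds
  have hsymm := h.symm.self_of_nhds
  have hdsymm : ∀ a b c, fderiv ℝ G x a b c = fderiv ℝ G x a c b := by
    intro a b c
    rw [fderiv_bilin_apply h.differentiableAt, fderiv_bilin_apply h.differentiableAt]
    congr 1
    refine Filter.EventuallyEq.fderiv_eq ?_
    filter_upwards [h.symm] with y hy using hy b c
  have key : fderiv ℝ G x u (gradient G φ x) w + G x (fderiv ℝ (gradient G φ) x u) w =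
      fderiv ℝ (fderiv ℝ φ) x u w := by
    have h1 : HasFDerivAt (fun y => G y (gradient G φ y)) _ x :=
      h.differentiableAt.hasFDerivAt.clm_apply (h.differentiableAt_gradient hφ).hasFDerivAt
    have h2 : (fun y => G y (gradient G φ y)) =ᶠ[𝓝 x] fderiv ℝ φ := by
      filter_upwards [h.isInvertible] with y hy
      ext w
      exact apply_gradient hy φ w
    have h3 := h1.fderiv
    rw [h2.fderiv_eq] at h3
    rw [h3]
    simp [add_comm]
  have e1 := apply_christoffel hinv u (gradient G φ x) w
  have e2 := apply_christoffel hinv u w (gradient G φ x)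
  have e3 : fderiv ℝ φ x (christoffel G x u w) = G x (christoffel G x u w) (gradient G φ x) := by
    rw [hsymm, apply_gradient hinv]
  rw [hessian_apply, e3, e2, map_add, add_apply, e1, ← key]
  simp only [christoffelFirst_apply]
  rw [hdsymm u w, hdsymm w u]
  ring

/-- The trace of the bilinear form `B` for the metric `G`. -/
def trace [FiniteDimensional ℝ E] (G : E →L[ℝ] E →L[ℝ] ℝ) (B : E →L[ℝ] E →L[ℝ] ℝ) : ℝ :=
  LinearMap.trace ℝ E (G.inverse ∘L B).toLinearMap

theorem IsMetricNear.trace_covariant_gradient [FiniteDimensional ℝ E]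
    {G : E → E →L[ℝ] E →L[ℝ] ℝ} {x : E} (h : IsMetricNear G x) {φ : E → ℝ}
    (hφ : ContDiffAt ℝ 2 φ x) :
    LinearMap.trace ℝ E (fderiv ℝ (gradient G φ) x +
      (christoffel G x).flip (gradient G φ x)).toLinearMap = trace (G x) (hessian G φ x) := by
  have : CompleteSpace E := FiniteDimensional.complete ℝ E
  unfold trace
  congr 1
  ext u
  refine (inverse_eq_of_apply_eq h.isInvertible.self_of_nhds ?_).symm
  ext w
  exact h.apply_covariant_gradient hφ u w

/-- The trace of an endomorphism of a product with `ℝ`, from its diagonal blocks. -/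
theorem trace_real_prod [FiniteDimensional ℝ E] (T : ℝ × E →ₗ[ℝ] ℝ × E) :
    LinearMap.trace ℝ (ℝ × E) T =
      (T (1, 0)).1 + LinearMap.trace ℝ E (LinearMap.snd ℝ ℝ E ∘ₗ T ∘ₗ LinearMap.inr ℝ ℝ E) := by
  have h1 : T = (T ∘ₗ LinearMap.inl ℝ ℝ E) ∘ₗ LinearMap.fst ℝ ℝ E +
      (T ∘ₗ LinearMap.inr ℝ ℝ E) ∘ₗ LinearMap.snd ℝ ℝ E := by
    refine LinearMap.ext fun z => ?_
    simp [← map_add]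
  have h2 : LinearMap.fst ℝ ℝ E ∘ₗ T ∘ₗ LinearMap.inl ℝ ℝ E =
      (T (1, 0)).1 • (LinearMap.id : ℝ →ₗ[ℝ] ℝ) := by
    ext; simp
  conv_lhs => rw [h1]
  rw [map_add, LinearMap.trace_comp_comm' (LinearMap.fst ℝ ℝ E),
    LinearMap.trace_comp_comm' (LinearMap.snd ℝ ℝ E), h2]
  simp

/-- The metric `-φ² dt² + G` on `ℝ × E`. -/
def staticCoord (G : E → E →L[ℝ] E →L[ℝ] ℝ) (φ : E → ℝ) (z : ℝ × E) :
    (ℝ × E) →L[ℝ] (ℝ × E) →L[ℝ] ℝ :=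
  (-(φ z.2) ^ 2) • pullbackForm (ContinuousLinearMap.fst ℝ ℝ E) (ContinuousLinearMap.mul ℝ ℝ)
    + pullbackForm (ContinuousLinearMap.snd ℝ ℝ E) (G z.2)

theorem staticCoord_apply (G : E → E →L[ℝ] E →L[ℝ] ℝ) (φ : E → ℝ) (z v w : ℝ × E) :
    staticCoord G φ z v w = -(φ z.2) ^ 2 * (v.1 * w.1) + G z.2 v.2 w.2 := rfl

theorem contDiffAt_staticCoord {G : E → E →L[ℝ] E →L[ℝ] ℝ} {φ : E → ℝ} {z : ℝ × E} {n : ℕ∞ω}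
    (hG : ContDiffAt ℝ n G z.2) (hφ : ContDiffAt ℝ n φ z.2) :
    ContDiffAt ℝ n (staticCoord G φ) z := by
  have h1 : ContDiffAt ℝ n (fun z : ℝ × E => φ z.2) z := hφ.comp z contDiffAt_snd
  have h2 : ContDiffAt ℝ n (fun z : ℝ × E => G z.2) z := hG.comp z contDiffAt_snd
  have h3 : ContDiffAt ℝ n (fun z : ℝ × E =>
      (-(φ z.2) ^ 2) • pullbackForm (ContinuousLinearMap.fst ℝ ℝ E)
        (ContinuousLinearMap.mul ℝ ℝ)) z := (h1.pow 2).neg.smul contDiffAt_const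
  have h4 : ContDiffAt ℝ n (fun z : ℝ × E =>
      pullbackForm (ContinuousLinearMap.snd ℝ ℝ E) (G z.2)) z :=
    contDiffAt_const.clm_comp (h2.clm_comp contDiffAt_const)
  exact h3.add h4

theorem isInvertible_staticCoord [FiniteDimensional ℝ E] {G : E → E →L[ℝ] E →L[ℝ] ℝ} {φ : E → ℝ}
    {z : ℝ × E} (hG : (G z.2).IsInvertible) (hφ : φ z.2 ≠ 0) :
    (staticCoord G φ z).IsInvertible := by
  refine isInvertible_of_nondegenerate _ fun v hv => ?_
  simp only [staticCoord_apply] at hv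
  refine Prod.ext ?_ ?_
  · simpa [hφ] using hv (1, 0)
  · refine hG.injective ?_
    ext w
    simpa using hv (0, w)

theorem IsMetricNear.staticCoord [FiniteDimensional ℝ E] {G : E → E →L[ℝ] E →L[ℝ] ℝ} {φ : E → ℝ}
    {z : ℝ × E} (h : IsMetricNear G z.2) (hφ : ContDiffAt ℝ 2 φ z.2) (h0 : φ z.2 ≠ 0) :
    IsMetricNear (staticCoord G φ) z where
  contDiffAt := contDiffAt_staticCoord h.contDiffAt hφ
  symm := by
    filter_upwards [continuousAt_snd.eventually h.symm] with y hy v w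
    rw [staticCoord_apply, staticCoord_apply, hy, mul_comm v.1]
  isInvertible := by
    filter_upwards [continuousAt_snd.eventually h.isInvertible,
      continuousAt_snd.eventually (hφ.continuousAt.eventually_ne h0)] with y hy hy'
    exact isInvertible_staticCoord hy hy'

theorem fderiv_staticCoord_apply {G : E → E →L[ℝ] E →L[ℝ] ℝ} {φ : E → ℝ} {z : ℝ × E}
    (hG : ContDiffAt ℝ 1 G z.2) (hφ : ContDiffAt ℝ 1 φ z.2) (u v w : ℝ × E) :
    fderiv ℝ (staticCoord G φ) z u v w =
      -(2 * φ z.2 * fderiv ℝ φ z.2 u.2) * (v.1 * w.1) + fderiv ℝ G z.2 u.2 v.2 w.2 := by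
  rw [fderiv_bilin_apply ((contDiffAt_staticCoord hG hφ).differentiableAt (by simp)),
    fderiv_bilin_apply (hG.differentiableAt (by simp))]
  have hsnd : HasFDerivAt (Prod.snd : ℝ × E → E) (ContinuousLinearMap.snd ℝ ℝ E) z :=
    hasFDerivAt_snd
  have h1 : HasFDerivAt (fun z : ℝ × E => φ z.2) _ z :=
    (hφ.differentiableAt (by simp)).hasFDerivAt.comp z hsnd
  have hG' : DifferentiableAt ℝ (fun y => G y v.2 w.2) z.2 :=
    ((hG.differentiableAt (by simp)).clm_apply (differentiableAt_const _)).clm_apply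
      (differentiableAt_const _)
  have h2 : HasFDerivAt (fun z : ℝ × E => G z.2 v.2 w.2) _ z := hG'.hasFDerivAt.comp z hsnd
  have h3 : HasFDerivAt (fun z => staticCoord G φ z v w) _ z :=
    ((h1.pow 2).neg.mul_const (v.1 * w.1)).add h2
  rw [h3.fderiv]
  simp
  ring

/-- The Christoffel symbols of a static metric. -/
theorem christoffel_staticCoord [FiniteDimensional ℝ E] {G : E → E →L[ℝ] E →L[ℝ] ℝ} {φ : E → ℝ}
    {z : ℝ × E} (hG : ContDiffAt ℝ 1 G z.2) (hinv : (G z.2).IsInvertible)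
    (hφ : ContDiffAt ℝ 1 φ z.2) (h0 : φ z.2 ≠ 0) (v w : ℝ × E) :
    christoffel (staticCoord G φ) z v w =
      ((φ z.2)⁻¹ * (fderiv ℝ φ z.2 v.2 * w.1 + fderiv ℝ φ z.2 w.2 * v.1),
        christoffel G z.2 v.2 w.2 + (v.1 * w.1 * φ z.2) • gradient G φ z.2) := by
  rw [christoffel_apply]
  refine inverse_eq_of_apply_eq (isInvertible_staticCoord hinv h0) ?_
  refine ContinuousLinearMap.ext fun u => ?_
  rw [staticCoord_apply, christoffelFirst_apply]
  simp only [fderiv_staticCoord_apply hG hφ, map_add, map_smul, add_apply, smul_apply,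
    apply_christoffel hinv, apply_gradient hinv, christoffelFirst_apply, smul_eq_mul]
  field_simp
  ring

theorem fderiv_christoffel_staticCoord [FiniteDimensional ℝ E] {G : E → E →L[ℝ] E →L[ℝ] ℝ}
    {φ : E → ℝ} {z : ℝ × E} (h : IsMetricNear G z.2) (hφ : ContDiffAt ℝ 2 φ z.2)
    (h0 : φ z.2 ≠ 0) (u v w : ℝ × E) :
    fderiv ℝ (christoffel (staticCoord G φ)) z u v w =
      ((φ z.2)⁻¹ * (fderiv ℝ (fderiv ℝ φ) z.2 u.2 v.2 * w.1
            + fderiv ℝ (fderiv ℝ φ) z.2 u.2 w.2 * v.1)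
          - ((φ z.2)⁻¹) ^ 2 * fderiv ℝ φ z.2 u.2 *
            (fderiv ℝ φ z.2 v.2 * w.1 + fderiv ℝ φ z.2 w.2 * v.1),
        fderiv ℝ (christoffel G) z.2 u.2 v.2 w.2
          + (v.1 * w.1) • (φ z.2 • fderiv ℝ (gradient G φ) z.2 u.2
            + fderiv ℝ φ z.2 u.2 • gradient G φ z.2)) := by
  have : CompleteSpace E := FiniteDimensional.complete ℝ E
  have hdΓ := (h.staticCoord hφ h0).contDiffAt_christoffel.differentiableAt (by simp)
  have hdΓ₀ := h.contDiffAt_christoffel.differentiableAt (by simp)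
  rw [fderiv_bilin_apply hdΓ, fderiv_bilin_apply hdΓ₀]
  have hev : (fun z => christoffel (staticCoord G φ) z v w) =ᶠ[𝓝 z] fun z =>
      ((φ z.2)⁻¹ * (fderiv ℝ φ z.2 v.2 * w.1 + fderiv ℝ φ z.2 w.2 * v.1),
        christoffel G z.2 v.2 w.2 + (v.1 * w.1) • (φ z.2 • gradient G φ z.2)) := by
    filter_upwards [continuousAt_snd.eventually h.eventually,
      continuousAt_snd.eventually (hφ.eventually (by simp)),
      continuousAt_snd.eventually (hφ.continuousAt.eventually_ne h0)] with y h1 h2 h3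
    rw [christoffel_staticCoord (h1.contDiffAt.of_le (by norm_num)) h1.isInvertible.self_of_nhds
      (h2.of_le (by norm_num)) h3, smul_smul]
  rw [hev.fderiv_eq]
  have hsnd : HasFDerivAt (Prod.snd : ℝ × E → E) (ContinuousLinearMap.snd ℝ ℝ E) z :=
    hasFDerivAt_snd
  have d1 : HasFDerivAt φ (fderiv ℝ φ z.2) z.2 :=
    (hφ.differentiableAt (by simp)).hasFDerivAt
  have d2 : ∀ a : E, HasFDerivAt (fun y => fderiv ℝ φ y a)
      ((fderiv ℝ (fderiv ℝ φ) z.2).flip a) z.2 := fun a => by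
    have := ((hφ.fderiv_right (m := 1) (by norm_num)).differentiableAt
      (by simp)).hasFDerivAt.clm_apply (hasFDerivAt_const a z.2)
    simpa using this
  have d3 : HasFDerivAt (fun y => (φ y)⁻¹) (-((φ z.2)⁻¹ ^ 2) • fderiv ℝ φ z.2) z.2 := by
    have := (hasDerivAt_inv h0).comp_hasFDerivAt z.2 d1
    simpa using! this
  have d4 : HasFDerivAt (fun y => christoffel G y v.2 w.2)
      (fderiv ℝ (fun y => christoffel G y v.2 w.2) z.2) z.2 :=
    ((hdΓ₀.clm_apply (differentiableAt_const _)).clm_apply (differentiableAt_const _)).hasFDerivAt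
  have d5 := d1.smul (h.differentiableAt_gradient hφ).hasFDerivAt
  have e1 := d3.mul (((d2 v.2).mul_const w.1).add ((d2 w.2).mul_const v.1))
  have e2 := d4.add (d5.const_smul (v.1 * w.1))
  have e3 := (e1.comp z hsnd).prodMk (e2.comp z hsnd)
  have e4 := e3.fderiv
  refine (congrArg (fun A => A u) e4).trans ?_
  refine Prod.ext ?_ ?_
  · simp
    ring
  · simp

/-- The Ricci tensor of a static metric. -/
theorem ricci_staticCoord [FiniteDimensional ℝ E] {G : E → E →L[ℝ] E →L[ℝ] ℝ}
    {φ : E → ℝ} {z : ℝ × E} (h : IsMetricNear G z.2) (hφ : ContDiffAt ℝ 2 φ z.2)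
    (h0 : φ z.2 ≠ 0) (v w : ℝ × E) :
    ricci (staticCoord G φ) z v w =
      ricci G z.2 v.2 w.2 - (φ z.2)⁻¹ * hessian G φ z.2 v.2 w.2
        + v.1 * w.1 * (φ z.2 * trace (G z.2) (hessian G φ z.2)) := by
  have hΓ := christoffel_staticCoord (h.contDiffAt.of_le (by norm_num))
    h.isInvertible.self_of_nhds (hφ.of_le (by norm_num)) h0
  have hdΓ := fderiv_christoffel_staticCoord h hφ h0
  rw [ricci_apply, trace_real_prod, ricci_apply, ← h.trace_covariant_gradient hφ]
  have h1 : ((curvature (staticCoord G φ) z v w) (1, 0)).1 =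
      -((φ z.2)⁻¹ * hessian G φ z.2 v.2 w.2) := by
    rw [curvature_apply, hessian_apply]
    simp only [hΓ, hdΓ, Prod.fst_add, Prod.fst_sub, map_zero, map_add, map_smul, zero_apply]
    simp
    field_simp
    ring
  have h2 : LinearMap.snd ℝ ℝ E ∘ₗ (curvature (staticCoord G φ) z v w).toLinearMap ∘ₗ
      LinearMap.inr ℝ ℝ E = (curvature G z.2 v.2 w.2).toLinearMap +
        (v.1 * w.1 * φ z.2) • (fderiv ℝ (gradient G φ) z.2 +
          (christoffel G z.2).flip (gradient G φ z.2)).toLinearMap := by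
    refine LinearMap.ext fun u => ?_
    change (curvature (staticCoord G φ) z v w (0, u)).2 = curvature G z.2 v.2 w.2 u +
      (v.1 * w.1 * φ z.2) • (fderiv ℝ (gradient G φ) z.2 u +
          christoffel G z.2 u (gradient G φ z.2))
    rw [curvature_apply, curvature_apply]
    simp only [hΓ, hdΓ, Prod.snd_add, Prod.snd_sub, map_add, map_smul]
    simp only [zero_mul, zero_smul, add_zero, mul_zero, smul_add, smul_smul]
    have e : v.1 * ((φ z.2)⁻¹ * (fderiv ℝ φ z.2 u * w.1)) * φ z.2 =
        v.1 * w.1 * fderiv ℝ φ z.2 u := by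
      field_simp
    rw [e]
    abel
  rw [h2, map_add, map_smul, smul_eq_mul]
  erw [h1]
  ring

end MetricCoord

section Chart

open Filter Topology

variable {E : Type*} [NormedAddCommGroup E] [NormedSpace ℝ E]
  {H : Type*} [TopologicalSpace H] {I : ModelWithCorners ℝ E H}
  {M : Type*} [TopologicalSpace M] [ChartedSpace H M] [IsManifold I ∞ M]

theorem mdifferentiableAt_extChartAt_symm [I.Boundaryless] {x : M} {y : E}
    (hy : y ∈ (extChartAt I x).target) :
    MDifferentiableAt 𝓘(ℝ, E) I (extChartAt I x).symm y := by
  have : IsManifold I 1 M := .of_le (n := ∞) (by simp)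
  simpa [I.range_eq_univ, mdifferentiableWithinAt_univ] using
    mdifferentiableWithinAt_extChartAt_symm hy

namespace PseudoRiemannianMetric

theorem dChart_apply (x : M) (v : TangentSpace I x) : dChart x v = v := by
  have : IsManifold I 1 M := .of_le (n := ∞) (by simp)
  unfold dChart
  rw [(mdifferentiableAt_extChartAt (mem_chart_source H x)).mfderiv]
  have h : writtenInExtChartAt I 𝓘(ℝ, E) x (extChartAt I x)
      =ᶠ[𝓝[Set.range I] (extChartAt I x x)] id := by
    filter_upwards [extChartAt_target_mem_nhdsWithin (I := I) x] with y hy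
    exact (extChartAt I x).right_inv hy
  rw [h.fderivWithin_eq ((extChartAt I x).right_inv (mem_extChartAt_target x)), fderivWithin_id]
  · rfl
  · exact I.uniqueDiffOn _ (Set.mem_range_self _)

theorem mfderiv_extChartAt_symm_self [I.Boundaryless] (x : M) (v : E) :
    (mfderiv 𝓘(ℝ, E) I (extChartAt I x).symm (extChartAt I x x) v : E) = v := by
  have : IsManifold I 1 M := .of_le (n := ∞) (by simp)
  have h := mfderiv_extChartAt_comp_mfderivWithin_extChartAt_symm' (mem_extChartAt_source (I := I) x)
  rw [I.range_eq_univ, mfderivWithin_univ] at h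
  have h1 := congrArg (fun L : E →L[ℝ] E => L v) h
  exact (dChart_apply (I := I) x (show E from
    mfderiv 𝓘(ℝ, E) I (extChartAt I x).symm (extChartAt I x x) v)).symm.trans h1

variable (g : PseudoRiemannianMetric I M)

theorem inChart_apply (x : M) (y v w : E) :
    g.inChart x y v w = g.inner ((extChartAt I x).symm y)
      (mfderiv 𝓘(ℝ, E) I (extChartAt I x).symm y v)
      (mfderiv 𝓘(ℝ, E) I (extChartAt I x).symm y w) := rfl

theorem inChart_self [I.Boundaryless] (x : M) (v w : E) :
    g.inChart x (extChartAt I x x) v w = g.inner x v w := by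
  let B : M → E →L[ℝ] E →L[ℝ] ℝ := fun z => g.inner z
  have h : g.inChart x (extChartAt I x x) v w =
    B ((extChartAt I x).symm (extChartAt I x x))
      (mfderiv 𝓘(ℝ, E) I (extChartAt I x).symm (extChartAt I x x) v)
      (mfderiv 𝓘(ℝ, E) I (extChartAt I x).symm (extChartAt I x x) w) := rfl
  rw [h, mfderiv_extChartAt_symm_self, mfderiv_extChartAt_symm_self, extChartAt_to_inv]
  rfl

theorem trace_eq [I.Boundaryless] [FiniteDimensional ℝ E] (x : M) (B : E →L[ℝ] E →L[ℝ] ℝ) :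
    g.trace x B = MetricCoord.trace (g.inChart x (extChartAt I x x)) B := by
  have h : g.inChart x (extChartAt I x x) = g.inner x := by
    ext v w
    exact g.inChart_self x v w
  rw [h]
  rfl

theorem ricci_eq [FiniteDimensional ℝ E] (x : M) :
    g.ricci x = MetricCoord.ricci (g.inChart x) (extChartAt I x x) := by
  ext v w
  have h : g.ricci x v w =
    MetricCoord.ricci (g.inChart x) (extChartAt I x x) (dChart x v) (dChart x w) := rfl
  rw [h, dChart_apply, dChart_apply]
  rfl

theorem hessian_eq (h : M → ℝ) (x : M) :
    g.hessian h x =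
      MetricCoord.hessian (g.inChart x) (h ∘ (extChartAt I x).symm) (extChartAt I x x) := by
  ext v w
  have h' : g.hessian h x v w = MetricCoord.hessian (g.inChart x) (h ∘ (extChartAt I x).symm)
    (extChartAt I x x) (dChart x v) (dChart x w) := rfl
  rw [h', dChart_apply, dChart_apply]
  rfl

theorem laplacian_eq [I.Boundaryless] [FiniteDimensional ℝ E] (h : M → ℝ) (x : M) :
    g.laplacian h x = MetricCoord.trace (g.inChart x (extChartAt I x x))
      (MetricCoord.hessian (g.inChart x) (h ∘ (extChartAt I x).symm) (extChartAt I x x)) := by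
  rw [laplacian, hessian_eq]
  exact g.trace_eq x _

theorem isInvertible_mfderiv_extChartAt_symm [I.Boundaryless] {x : M} {y : E}
    (hy : y ∈ (extChartAt I x).target) :
    (mfderiv 𝓘(ℝ, E) I (extChartAt I x).symm y).IsInvertible := by
  have : IsManifold I 1 M := .of_le (n := ∞) (by simp)
  have h := isInvertible_mfderivWithin_extChartAt_symm hy
  rwa [I.range_eq_univ, mfderivWithin_univ] at h

theorem isInvertible_inChart [I.Boundaryless] [FiniteDimensional ℝ E] {x : M} {y : E}
    (hy : y ∈ (extChartAt I x).target) : (g.inChart x y).IsInvertible := by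
  have hA := isInvertible_mfderiv_extChartAt_symm (I := I) hy
  refine MetricCoord.isInvertible_of_nondegenerate _ fun v hv => ?_
  have h0 := g.nondegenerate _ (mfderiv 𝓘(ℝ, E) I (extChartAt I x).symm y v) fun w => by
    obtain ⟨u, rfl⟩ := hA.surjective w
    exact hv u
  exact hA.injective (h0.trans (map_zero _).symm)

theorem contDiffAt_inChart [I.Boundaryless] (x : M) :
    ContDiffAt ℝ ∞ (g.inChart x) (extChartAt I x x) := by
  have : IsManifold I 1 M := .of_le (n := ∞) (by simp)
  have h1 := ((contMDiffAt_hom_bundle _).1 (g.contMDiff x)).2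
  have hsymm : ContMDiffAt 𝓘(ℝ, E) I ∞ (extChartAt I x).symm (extChartAt I x x) :=
    (contMDiffOn_extChartAt_symm x).contMDiffAt (extChartAt_target_mem_nhds x)
  rw [← extChartAt_to_inv (I := I) x] at h1
  have h2 := (h1.comp (extChartAt I x x) hsymm).contDiffAt
  simp only [extChartAt_to_inv] at h2
  refine h2.congr_of_eventuallyEq ?_
  filter_upwards [extChartAt_target_mem_nhds (I := I) x] with y hy
  have hz : (extChartAt I x).symm y ∈ (chartAt H x).source := by
    rw [← extChartAt_source (I := I)]
    exact (extChartAt I x).map_target hy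
  have hz' : (extChartAt I x).symm y ∈ (trivializationAt E (TangentSpace I) x).baseSet := by
    simpa using hz
  ext v w
  symm
  erw [inCoordinates_apply_eq₂ hz' hz' (by simp)]
  have hA : ∀ v : E, (trivializationAt E (TangentSpace I) x).symm ((extChartAt I x).symm y) v =
      mfderiv 𝓘(ℝ, E) I (extChartAt I x).symm y v := by
    intro v
    have h := TangentBundle.symmL_trivializationAt (I := I) hz
    rw [I.range_eq_univ, mfderivWithin_univ, (extChartAt I x).right_inv hy] at h
    rw [← h]
    exact (Trivialization.symmL_apply (R := ℝ) _ hz' v).symm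
  rw [hA, hA]
  simp [inChart_apply]

theorem isMetricNear_inChart [I.Boundaryless] [FiniteDimensional ℝ E] (x : M) :
    MetricCoord.IsMetricNear (g.inChart x) (extChartAt I x x) where
  contDiffAt := (g.contDiffAt_inChart x).of_le (WithTop.coe_le_coe.2 (le_top : (2 : ℕ∞) ≤ ⊤))
  symm := .of_forall fun y v w => g.symm _ _ _
  isInvertible := by
    filter_upwards [extChartAt_target_mem_nhds (I := I) x] with y hy
    exact g.isInvertible_inChart hy

end PseudoRiemannianMetric

theorem contDiffAt_comp_extChartAt_symm [I.Boundaryless] {f : M → ℝ}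
    (hf : ContMDiff I 𝓘(ℝ, ℝ) ∞ f) (x : M) :
    ContDiffAt ℝ ∞ (f ∘ (extChartAt I x).symm) (extChartAt I x x) := by
  have hsymm : ContMDiffAt 𝓘(ℝ, E) I ∞ (extChartAt I x).symm (extChartAt I x x) :=
    (contMDiffOn_extChartAt_symm x).contMDiffAt (extChartAt_target_mem_nhds x)
  exact (hf.contMDiffAt.comp (extChartAt I x x) hsymm).contDiffAt

end Chart

section StaticChart

open Filter Topology

variable {E : Type*} [NormedAddCommGroup E] [NormedSpace ℝ E]
  {H : Type*} [TopologicalSpace H] {J : ModelWithCorners ℝ E H}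
  {F : Type*} [TopologicalSpace F] [ChartedSpace H F] [IsManifold J ∞ F]

theorem dTime_mfderiv_extChartAt_symm [J.Boundaryless] {a b : EReal} (q : openInterval a b × F)
    {y : ℝ × E} (hy : y ∈ (extChartAt (𝓘(ℝ, ℝ).prod J) q).target) (v : ℝ × E) :
    dTime J ((extChartAt (𝓘(ℝ, ℝ).prod J) q).symm y)
      (mfderiv 𝓘(ℝ, ℝ × E) (𝓘(ℝ, ℝ).prod J) (extChartAt (𝓘(ℝ, ℝ).prod J) q).symm y v) = v.1 := by
  have ht : MDifferentiableAt (𝓘(ℝ, ℝ).prod J) 𝓘(ℝ, ℝ)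
      (fun q : openInterval a b × F ↦ (q.1 : ℝ)) ((extChartAt (𝓘(ℝ, ℝ).prod J) q).symm y) :=
    ((contMDiff_subtype_val (n := 1)).comp contMDiff_fst).mdifferentiableAt (by simp)
  have h := mfderiv_comp y ht (mdifferentiableAt_extChartAt_symm hy)
  have hev : (fun q : openInterval a b × F ↦ (q.1 : ℝ)) ∘
      (extChartAt (𝓘(ℝ, ℝ).prod J) q).symm =ᶠ[𝓝 y] Prod.fst := by
    filter_upwards [(isOpen_extChartAt_target (I := 𝓘(ℝ, ℝ).prod J) q).mem_nhds hy] with z hz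
    rw [extChartAt_prod] at hz ⊢
    exact (extChartAt 𝓘(ℝ, ℝ) q.1).right_inv hz.1
  rw [hev.mfderiv_eq, mfderiv_eq_fderiv, fderiv_fst] at h
  exact (congrArg (fun L : (ℝ × E) →L[ℝ] ℝ => L v) h).symm

theorem dFiber_mfderiv_extChartAt_symm [J.Boundaryless] {a b : EReal} (q : openInterval a b × F)
    {y : ℝ × E} (hy : y ∈ (extChartAt (𝓘(ℝ, ℝ).prod J) q).target) (v : ℝ × E) :
    (dFiber J ((extChartAt (𝓘(ℝ, ℝ).prod J) q).symm y)
      (mfderiv 𝓘(ℝ, ℝ × E) (𝓘(ℝ, ℝ).prod J) (extChartAt (𝓘(ℝ, ℝ).prod J) q).symm y v) : E) =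
      mfderiv 𝓘(ℝ, E) J (extChartAt J q.2).symm y.2 v.2 := by
  have h := mfderiv_comp y (mdifferentiableAt_snd (I := 𝓘(ℝ, ℝ)) (I' := J)
      (x := (extChartAt (𝓘(ℝ, ℝ).prod J) q).symm y)) (mdifferentiableAt_extChartAt_symm hy)
  have hev : (Prod.snd : openInterval a b × F → F) ∘
      (extChartAt (𝓘(ℝ, ℝ).prod J) q).symm = (extChartAt J q.2).symm ∘ Prod.snd := by
    ext z
    rw [extChartAt_prod]
    rfl
  have hy2 : y.2 ∈ (extChartAt J q.2).target := by
    rw [extChartAt_prod] at hy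
    exact hy.2
  have hsnd : MDifferentiableAt 𝓘(ℝ, ℝ × E) 𝓘(ℝ, E) (Prod.snd : ℝ × E → E) y :=
    differentiableAt_snd.mdifferentiableAt
  have h' := mfderiv_comp y (mdifferentiableAt_extChartAt_symm hy2) hsnd
  rw [mfderiv_eq_fderiv, fderiv_snd] at h'
  have e := congrArg (fun φ : ℝ × E → F => (mfderiv 𝓘(ℝ, ℝ × E) J φ y v : E)) hev
  have e1 := congrArg (fun L : (ℝ × E) →L[ℝ] E => L v) h
  have e2 := congrArg (fun L : (ℝ × E) →L[ℝ] E => L v) h'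
  exact e1.symm.trans (e.trans e2)

/-- In a product chart, a static metric is `-φ² dt² + G`. -/
theorem inChart_staticMetric [J.Boundaryless]
    (gF : ContMDiffRiemannianMetric J ∞ E (fun p : F ↦ TangentSpace J p)) (f : F → ℝ)
    (hf : ContMDiff J 𝓘(ℝ, ℝ) ∞ f) (hpos : ∀ p, 0 < f p) (a b : EReal)
    (q : openInterval a b × F) :
    (staticMetric gF f hf hpos a b).inChart q =ᶠ[𝓝 (extChartAt (𝓘(ℝ, ℝ).prod J) q q)]
      MetricCoord.staticCoord (gF.toPseudo.inChart q.2) (f ∘ (extChartAt J q.2).symm) := by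
  filter_upwards [extChartAt_target_mem_nhds (I := 𝓘(ℝ, ℝ).prod J) q] with y hy
  have hp : ((extChartAt (𝓘(ℝ, ℝ).prod J) q).symm y).2 = (extChartAt J q.2).symm y.2 := by
    rw [extChartAt_prod]
    rfl
  refine ContinuousLinearMap.ext fun v => ContinuousLinearMap.ext fun w => ?_
  let B : F → E →L[ℝ] E →L[ℝ] ℝ := fun z => gF.inner z
  have hB : ∀ {z z' : F} {c c' d d' : E}, z = z' → c = c' → d = d' → B z c d = B z' c' d' := by
    rintro z _ c _ d _ rfl rfl rfl
    rfl
  let A : (ℝ × E) →L[ℝ] TangentSpace (𝓘(ℝ, ℝ).prod J)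
      ((extChartAt (𝓘(ℝ, ℝ).prod J) q).symm y) :=
    mfderiv 𝓘(ℝ, ℝ × E) (𝓘(ℝ, ℝ).prod J) (extChartAt (𝓘(ℝ, ℝ).prod J) q).symm y
  have h : (staticMetric gF f hf hpos a b).inChart q y v w =
      -(f ((extChartAt (𝓘(ℝ, ℝ).prod J) q).symm y).2) ^ 2 *
        (dTime J ((extChartAt (𝓘(ℝ, ℝ).prod J) q).symm y) (A v) *
          dTime J ((extChartAt (𝓘(ℝ, ℝ).prod J) q).symm y) (A w)) +
      B ((extChartAt (𝓘(ℝ, ℝ).prod J) q).symm y).2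
        (dFiber J ((extChartAt (𝓘(ℝ, ℝ).prod J) q).symm y) (A v))
        (dFiber J ((extChartAt (𝓘(ℝ, ℝ).prod J) q).symm y) (A w)) := rfl
  refine h.trans (congrArg₂ (· + ·) ?_
    (hB hp (dFiber_mfderiv_extChartAt_symm q hy v) (dFiber_mfderiv_extChartAt_symm q hy w)))
  exact congrArg₂ (· * ·) (congrArg (fun z => -(f z) ^ 2) hp)
    (congrArg₂ (· * ·) (dTime_mfderiv_extChartAt_symm q hy v)
      (dTime_mfderiv_extChartAt_symm q hy w))

omit [IsManifold J ∞ F] in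
theorem extChartAt_prod_self_snd {a b : EReal} (q : openInterval a b × F) :
    (extChartAt (𝓘(ℝ, ℝ).prod J) q q).2 = extChartAt J q.2 q.2 := by
  rw [extChartAt_prod]
  rfl

theorem staticMetric_inner_apply [J.Boundaryless]
    (gF : ContMDiffRiemannianMetric J ∞ E (fun p : F ↦ TangentSpace J p)) (f : F → ℝ)
    (hf : ContMDiff J 𝓘(ℝ, ℝ) ∞ f) (hpos : ∀ p, 0 < f p) (a b : EReal)
    (q : openInterval a b × F) (v w : ℝ × E) :
    (staticMetric gF f hf hpos a b).inner q v w =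
      -(f q.2) ^ 2 * (v.1 * w.1) + gF.inner q.2 v.2 w.2 := by
  have h := (staticMetric gF f hf hpos a b).inChart_self q v w
  rw [(inChart_staticMetric gF f hf hpos a b q).eq_of_nhds, MetricCoord.staticCoord_apply,
    extChartAt_prod_self_snd, gF.toPseudo.inChart_self, Function.comp_apply,
    extChartAt_to_inv] at h
  exact h.symm

/-- The Ricci tensor of a standard static space-time. -/
theorem ricci_staticMetric [J.Boundaryless] [FiniteDimensional ℝ E]
    (gF : ContMDiffRiemannianMetric J ∞ E (fun p : F ↦ TangentSpace J p)) (f : F → ℝ)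
    (hf : ContMDiff J 𝓘(ℝ, ℝ) ∞ f) (hpos : ∀ p, 0 < f p) (a b : EReal)
    (q : openInterval a b × F) (v w : ℝ × E) :
    (staticMetric gF f hf hpos a b).ricci q v w =
      gF.toPseudo.ricci q.2 v.2 w.2 - (f q.2)⁻¹ * gF.toPseudo.hessian f q.2 v.2 w.2
        + v.1 * w.1 * (f q.2 * gF.toPseudo.laplacian f q.2) := by
  have hG := gF.toPseudo.isMetricNear_inChart q.2
  have hφ : ContDiffAt ℝ 2 (f ∘ (extChartAt J q.2).symm) (extChartAt J q.2 q.2) :=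
    (contDiffAt_comp_extChartAt_symm hf q.2).of_le (WithTop.coe_le_coe.2 (le_top : (2 : ℕ∞) ≤ ⊤))
  have hφp : (f ∘ (extChartAt J q.2).symm) (extChartAt J q.2 q.2) = f q.2 := by
    rw [Function.comp_apply, extChartAt_to_inv]
  rw [← extChartAt_prod_self_snd q] at hG hφ hφp
  have h := MetricCoord.ricci_staticCoord hG hφ (by rw [hφp]; exact (hpos _).ne') v w
  rw [← MetricCoord.ricci_congr (inChart_staticMetric gF f hf hpos a b q), hφp,
    extChartAt_prod_self_snd, ← gF.toPseudo.laplacian_eq, ← gF.toPseudo.hessian_eq,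
    ← gF.toPseudo.ricci_eq] at h
  rw [PseudoRiemannianMetric.ricci_eq]
  exact h

end StaticChart

namespace PseudoRiemannianMetric

variable {E : Type*} [NormedAddCommGroup E] [NormedSpace ℝ E] [FiniteDimensional ℝ E]
  {H : Type*} [TopologicalSpace H] {I : ModelWithCorners ℝ E H}
  {M : Type*} [TopologicalSpace M] [ChartedSpace H M] [IsManifold I ∞ M]
  (g : PseudoRiemannianMetric I M)

theorem trace_inner (x : M) : g.trace x (g.inner x) = Module.finrank ℝ E := by
  let B : E →L[ℝ] E →L[ℝ] ℝ := g.inner x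
  have hB : B.IsInvertible := MetricCoord.isInvertible_of_nondegenerate B (g.nondegenerate x)
  have h : MetricCoord.trace B B = Module.finrank ℝ E := by
    rw [MetricCoord.trace, hB.inverse_comp_self]
    exact LinearMap.trace_id ℝ E
  exact h

theorem trace_eq_of_apply_eq (x : M)
    {A B C : TangentSpace I x →L[ℝ] TangentSpace I x →L[ℝ] ℝ} {b c : ℝ}
    (h : ∀ v w, A v w = b * B v w + c * C v w) :
    g.trace x A = b * g.trace x B + c * g.trace x C := by
  let G : E →L[ℝ] E →L[ℝ] ℝ := g.inner x
  let A' : E →L[ℝ] E →L[ℝ] ℝ := A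
  let B' : E →L[ℝ] E →L[ℝ] ℝ := B
  let C' : E →L[ℝ] E →L[ℝ] ℝ := C
  have hA : A' = b • B' + c • C' :=
    ContinuousLinearMap.ext fun v => ContinuousLinearMap.ext fun w => h v w
  have h' : MetricCoord.trace G A' = b * MetricCoord.trace G B' + c * MetricCoord.trace G C' := by
    rw [hA]
    simp [MetricCoord.trace, ContinuousLinearMap.comp_add]
  exact h'

end PseudoRiemannianMetric

theorem openInterval_nonempty {a b : EReal} (hab : a < b) : Nonempty (openInterval a b) := by
  obtain ⟨t, h1, h2⟩ := EReal.lt_iff_exists_real_btwn.1 hab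
  exact ⟨⟨t, h1, h2⟩⟩

end

theorem mainTheorem10 {s : ℕ} (hs : 2 ≤ s) {F : Type*} [TopologicalSpace F]
    [ChartedSpace (EuclideanSpace ℝ (Fin s)) F] [IsManifold (𝓡 s) ∞ F]
    (gF : ContMDiffRiemannianMetric (𝓡 s) ∞ (EuclideanSpace ℝ (Fin s))
      (fun p : F ↦ TangentSpace (𝓡 s) p))
    (f : F → ℝ) (hf : ContMDiff (𝓡 s) 𝓘(ℝ, ℝ) ∞ f) (hpos : ∀ p, 0 < f p)
    (a b : EReal) (hab : a < b) (n : ℕ) (hn : n = s + 1) (τ : ℝ)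
    (hE : (staticMetric gF f hf hpos a b).IsEinstein)
    (hτ : ∀ q, (staticMetric gF f hf hpos a b).scalarCurvature q = τ) :
    ((∀ p : F, gF.toPseudo.laplacian f p = -(τ / n) * f p) ∧
      ∀ (p : F) (v w : TangentSpace (𝓡 s) p),
        gF.toPseudo.ricci p v w =
          1 / f p * gF.toPseudo.hessian f p v w + τ / n * gF.inner p v w) ∧
    ∀ p : F, ((s : ℝ) + 1) * gF.toPseudo.scalarCurvature p = ((s : ℝ) - 1) * τ := by
  obtain ⟨t⟩ := openInterval_nonempty hab
  obtain ⟨lam, -, hlam⟩ := hE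
  set g := staticMetric gF f hf hpos a b
  have hn0 : (n : ℝ) ≠ 0 := by rw [hn]; positivity
  have hlamτ : ∀ q, lam q = τ / n := by
    intro q
    have h2 := hτ q
    rw [PseudoRiemannianMetric.scalarCurvature,
      g.trace_eq_of_apply_eq q (B := g.inner q) (C := g.inner q) (b := lam q) (c := 0)
        (fun v w => by rw [hlam]; ring), g.trace_inner] at h2
    rw [eq_div_iff hn0, ← h2, hn]
    simp [add_comm]
  have key : ∀ (p : F) (v w : ℝ × EuclideanSpace ℝ (Fin s)),
      gF.toPseudo.ricci p v.2 w.2 - (f p)⁻¹ * gF.toPseudo.hessian f p v.2 w.2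
        + v.1 * w.1 * (f p * gF.toPseudo.laplacian f p) =
      τ / n * (-(f p) ^ 2 * (v.1 * w.1) + gF.inner p v.2 w.2) := by
    intro p v w
    rw [← ricci_staticMetric gF f hf hpos a b (t, p) v w,
      ← staticMetric_inner_apply gF f hf hpos a b (t, p) v w, ← hlamτ (t, p)]
    exact hlam (t, p) v w
  have hlap : ∀ p : F, gF.toPseudo.laplacian f p = -(τ / n) * f p := by
    intro p
    have hR : gF.toPseudo.ricci p 0 0 = 0 := map_zero _
    have hH : gF.toPseudo.hessian f p 0 0 = 0 := map_zero _
    have hI : gF.inner p 0 0 = 0 := map_zero _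
    have h : gF.toPseudo.ricci p 0 0 - (f p)⁻¹ * gF.toPseudo.hessian f p 0 0
        + 1 * 1 * (f p * gF.toPseudo.laplacian f p) =
        τ / n * (-(f p) ^ 2 * (1 * 1) + gF.inner p 0 0) := key p (1, 0) (1, 0)
    rw [hR, hH, hI] at h
    simp only [mul_zero, sub_zero, mul_one, one_mul, zero_add, add_zero] at h
    refine mul_left_cancel₀ (hpos p).ne' (h.trans ?_)
    ring
  have hric : ∀ (p : F) (v w : TangentSpace (𝓡 s) p), gF.toPseudo.ricci p v w =
      1 / f p * gF.toPseudo.hessian f p v w + τ / n * gF.inner p v w := by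
    intro p v w
    have h := key p (0, v) (0, w)
    simp only [mul_zero, zero_mul, zero_add, add_zero] at h
    rw [one_div]
    linarith
  refine ⟨⟨hlap, hric⟩, fun p => ?_⟩
  have h2 : gF.toPseudo.trace p (gF.toPseudo.hessian f p) = -(τ / n) * f p := hlap p
  rw [PseudoRiemannianMetric.scalarCurvature,
    gF.toPseudo.trace_eq_of_apply_eq p (C := gF.toPseudo.inner p) (hric p),
    gF.toPseudo.trace_inner, h2, finrank_euclideanSpace_fin]
  have hf0 := (hpos p).ne'
  rw [hn] at hn0 ⊢
  push_cast at hn0 ⊢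
  field_simp
  ring
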